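/- Let $G=(V,E)$ be a finite undirected graph (parallel edges and loops are allowed), let $\mathbf R=\{r_1,\dots,r_t\}$ be a multiset of vertices of $G$, and let $\mathcal M$ be a matroid on $\mathbf R$ (that is, on the $t$ members of the multiset, counted separately) with rank function $r_{\mathcal M}$ and rank $k\ge 1$. For $C\subseteq E$ let $V(C)$ be the set of vertices incident to an edge of $C$. A pair $(C,r)$ with $C\subseteq E$ and $r\in V$ is a *rooted-component* if either $C=\emptyset$, or $C$ is connected (any two vertices of $V(C)$ are joined by a walk using only edges of $C$) and $r\in V(C)$. Put $V(C,r)=V(C)\cup\{r\}$. For $X\subseteq V$ let $\mathbf R_X$ be the multiset $\{r_i\in\mathbf R\mid r_i\in X\}$, and for a partition $\mathcal P$ of $V$ let $\delta_G(\mathcal P)$ be the set of edges of $G$ joining two distinct members of $\mathcal P$. **Theorem.** The edge set $E$ can be partitioned into pairwise disjoint (possibly empty) sets $C_1,\dots,C_t$ such that each $(C_i,r_i)$ is a rooted-component and, for every $v\in V$, the multiset $\{r_i\in\mathbf R\mid v\in V(C_i,r_i)\}$ is a spanning set of $\mathcal M$, if and only if $$|\delta_G(\mathcal P)|\ \ge\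 k|\mathcal P|-\sum_{X\in\mathcal P}r_{\mathcal M}(\mathbf R_X)$$ for every partition $\mathcal P$ of $V$ into non-empty subsets. -/

import Mathlib

open scoped Graph

namespace RootedDecomposition

variable {α β ι : Type*}

/-- `V(C)`: the set of vertices of `G` incident to some edge of `C`. -/
def edgeVertices (G : Graph α β) (C : Set β) : Set α :=
  {v | ∃ e ∈ C, G.Inc e v}

/-- `V(C, r) = V(C) ∪ {r}`: the set of vertices spanned by the pair `(C, r)`. -/
def spannedVertices (G : Graph α β) (C : Set β) (r : α) : Set α :=
  edgeVertices G C ∪ {r}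

/-- The edge set `C` is connected: any two vertices incident to edges of `C` are joined by a walk
all of whose edges lie in `C`. -/
def EdgeConnected (G : Graph α β) (C : Set β) : Prop :=
  ∀ x ∈ edgeVertices G C, ∀ y ∈ edgeVertices G C,
    Relation.ReflTransGen (fun u v => ∃ e ∈ C, G.IsLink e u v) x y

/-- `(C, r)` is a rooted-component of `G`: `C` is a set of edges and `r` a vertex of `G`, and either
`C` is empty, or `C` is connected and `r` is a vertex of `C`. -/
structure IsRootedComponent (G : Graph α β) (C : Set β) (r : α) : Prop where
  subset_edgeSet : C ⊆ E(G)
  root_mem : r ∈ V(G)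
  empty_or_connected : C = ∅ ∨ (EdgeConnected G C ∧ r ∈ edgeVertices G C)

/-- `(C i, r i)`, `i : ι`, is a decomposition of `(G, r)` into rooted-components: the (possibly
empty) sets `C i` are pairwise disjoint and their union is the whole edge set of `G`. -/
structure IsRootedComponentDecomposition (G : Graph α β) (r : ι → α) (C : ι → Set β) : Prop where
  isRootedComponent : ∀ i, IsRootedComponent G (C i) (r i)
  disjoint : ∀ i j, i ≠ j → Disjoint (C i) (C j)
  iUnion_eq : ⋃ i, C i = E(G)

/-- `δ_G(P)`: the set of edges of `G` connecting two distinct members of the partition `P`. -/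
def crossingEdges (G : Graph α β) (P : Finpartition V(G)) : Set β :=
  {e | ∃ X ∈ P.parts, ∃ Y ∈ P.parts, X ≠ Y ∧ ∃ x ∈ X, ∃ y ∈ Y, G.IsLink e x y}

/-- `R_X`: the sub-multiset of the roots lying in `X`, as a set of indices. -/
def rootsIn (r : ι → α) (X : Set α) : Set ι := {i | r i ∈ X}

/-- The rank function of a matroid of finite rank, with natural number values. -/
noncomputable def rank (M : Matroid ι) (X : Set ι) : ℕ := (M.eRk X).toNat

end RootedDecomposition

/-! Necessity is a count. For a vertex v of a part X, the components spanning v have rank k in `M`;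
roots inside X contribute rank at most that of R_X, so at least k minus this rank of the components
reach X from a root outside. With the parts contracted, a connected component needs a crossing edge
for each part it meets beyond that of its root, and the components are edge-disjoint
(`IsRootedComponent.card_parts_le`).

Sufficiency goes through orientations. The demand k minus the rank of R_X is supermodular in X, and
the partition inequality is exactly what Frank's theorem (`exists_orientation`) needs to orient G so
that every nonempty X is entered by at least that many arcs. Components then grow from empty sets,
one arc at a time. Each vertex carries the indices of the components spanning it, and the invariant
is: unused arcs entering X plus the rank of the labels in X is at least k. While some vertex has
non-spanning labels, uncrossing tight sets yields an arc that can pass a label to its head without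
breaking the invariant (`exists_arc`). Arcs run out, so eventually all vertices are spanned;
leftover edges are attached to components already at one of their ends. -/

namespace RootedDecomposition

/-! ### Orientations covering an intersecting supermodular demand -/

section Orientation

open Finset
open scoped Classical

variable {α β : Type*}

/-- The edges of `F`, with ends given by `a` and `b`, that have both ends in `X`. -/
noncomputable def inducedEdges (F : Finset β) (a b : β → α) (X : Finset α) : Finset β :=
  F.filter fun e => a e ∈ X ∧ b e ∈ X

/-- The arcs of `F`, with heads and tails given by `hd` and `tl`, that enter `X`. -/
noncomputable def enteringArcs (F : Finset β) (tl hd : β → α) (X : Finset α) : Finset β :=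
  F.filter fun e => hd e ∈ X ∧ tl e ∉ X

lemma card_inducedEdges_add_le (F : Finset β) (a b : β → α) (X Y : Finset α) :
    #(inducedEdges F a b X) + #(inducedEdges F a b Y) ≤
      #(inducedEdges F a b (X ∪ Y)) + #(inducedEdges F a b (X ∩ Y)) := by
  rw [← card_union_add_card_inter]
  refine Nat.add_le_add (card_le_card ?_) (card_le_card ?_) <;>
  · intro e
    simp only [inducedEdges, mem_union, mem_inter, mem_filter]
    tauto

lemma card_enteringArcs_add_le (F : Finset β) (tl hd : β → α) (X Y : Finset α) :
    #(enteringArcs F tl hd (X ∪ Y)) + #(enteringArcs F tl hd (X ∩ Y)) ≤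
      #(enteringArcs F tl hd X) + #(enteringArcs F tl hd Y) := by
  rw [← card_union_add_card_inter (enteringArcs F tl hd X), ← card_union_add_card_inter]
  refine Nat.add_le_add (card_le_card ?_) (card_le_card ?_) <;>
  · intro e
    simp only [enteringArcs, mem_union, mem_inter, mem_filter]
    tauto

/-- If `p` is intersecting supermodular and its value on partitions of `W` is at most `N`, then
`p` is dominated by a modular function of total value at most `N`. -/
lemma exists_sum_ge_of_supermodular (W : Finset α) (p : Finset α → ℕ) (N : ℕ)
    (hp : ∀ X ⊆ W, ∀ Y ⊆ W, (X ∩ Y).Nonempty → p X + p Y ≤ p (X ∪ Y) + p (X ∩ Y))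
    (hN : ∀ P : Finset (Finset α), (∀ X ∈ P, X.Nonempty) →
      (∀ X ∈ P, ∀ Y ∈ P, (X ∩ Y).Nonempty → X = Y) → P.biUnion id = W → ∑ X ∈ P, p X ≤ N) :
    ∃ m : α → ℕ, (∀ X ⊆ W, X.Nonempty → p X ≤ ∑ v ∈ X, m v) ∧ ∑ v ∈ W, m v ≤ N := by
  let S : Set (α → ℕ) := {m | ∀ X ⊆ W, X.Nonempty → p X ≤ ∑ v ∈ X, m v}
  have hS : S.Nonempty := by
    refine ⟨fun _ => ∑ X ∈ W.powerset, p X, fun X hX hne => ?_⟩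
    obtain ⟨v, hv⟩ := hne
    calc p X ≤ ∑ X ∈ W.powerset, p X :=
          single_le_sum (f := p) (fun _ _ => Nat.zero_le _) (mem_powerset.2 hX)
      _ ≤ _ := single_le_sum (f := fun _ => ∑ X ∈ W.powerset, p X) (fun _ _ => Nat.zero_le _) hv
  -- A feasible `m` of least total weight; it remains to find a partition of `W` on which `p` and
  -- `m` agree.
  obtain ⟨m, hm, hmin⟩ := (measure fun m : α → ℕ => ∑ v ∈ W, m v).wf.has_min S hS
  refine ⟨m, hm, ?_⟩
  have hunion : ∀ X ⊆ W, ∀ Y ⊆ W, (X ∩ Y).Nonempty → p X = ∑ v ∈ X, m v → p Y = ∑ v ∈ Y, m v →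
      p (X ∪ Y) = ∑ v ∈ X ∪ Y, m v := by
    intro X hX Y hY hne h1 h2
    have h3 := hp X hX Y hY hne
    have h4 := hm _ (inter_subset_left.trans hX : X ∩ Y ⊆ W) hne
    have h5 := hm _ (union_subset hX hY) (hne.mono (inter_subset_left.trans subset_union_left))
    have h6 := sum_union_inter (s₁ := X) (s₂ := Y) (f := m)
    omega
  -- By minimality, lowering `m v` by one violates the constraint of some set, which must contain
  -- `v` and be tight. If `m v = 0` it cannot be lowered, but then `{v}` is tight.
  have htight : ∀ v ∈ W, ∃ X ⊆ W, v ∈ X ∧ p X = ∑ v ∈ X, m v := by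
    intro v hv
    by_cases h0 : m v = 0
    · refine ⟨{v}, by simpa using hv, by simp, ?_⟩
      have := hm {v} (by simpa using hv) (by simp)
      simp only [sum_singleton] at this ⊢
      omega
    · have hupd : ∀ X : Finset α, v ∈ X →
          ∑ w ∈ X, Function.update m v (m v - 1) w + 1 = ∑ w ∈ X, m w := by
        intro X hX
        rw [sum_update_of_mem hX, ← add_sum_erase X m hX, sdiff_singleton_eq_erase]
        omega
      have hnot : Function.update m v (m v - 1) ∉ S := by
        intro hmem
        refine hmin _ hmem ?_
        change ∑ w ∈ W, Function.update m v (m v - 1) w < ∑ w ∈ W, m w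
        have := hupd W hv
        omega
      simp only [S, Set.mem_ofPred_eq, not_forall] at hnot
      obtain ⟨X, hX, hne, hlt⟩ := hnot
      have h1 := hm X hX hne
      by_cases hvX : v ∈ X
      · refine ⟨X, hX, hvX, ?_⟩
        have := hupd X hvX
        omega
      · rw [sum_update_of_notMem hvX] at hlt
        exact absurd h1 hlt
  -- Intersecting tight sets have a tight union, so a largest tight set through `v` absorbs every
  -- tight set meeting it. These sets partition `W`.
  have hmax : ∀ v ∈ W, ∃ X ⊆ W, v ∈ X ∧ p X = ∑ v ∈ X, m v ∧
      ∀ Y ⊆ W, (X ∩ Y).Nonempty → p Y = ∑ v ∈ Y, m v → Y ⊆ X := by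
    intro v hv
    obtain ⟨X₀, hX₀, hvX₀, ht₀⟩ := htight v hv
    obtain ⟨X, hX, hXmax⟩ := exists_max_image
      (W.powerset.filter fun X => v ∈ X ∧ p X = ∑ v ∈ X, m v) card
      ⟨X₀, by simp only [mem_filter, mem_powerset]; exact ⟨hX₀, hvX₀, ht₀⟩⟩
    simp only [mem_filter, mem_powerset] at hX hXmax
    refine ⟨X, hX.1, hX.2.1, hX.2.2, fun Y hY hne hYt => ?_⟩
    have h1 := hXmax (X ∪ Y) ⟨union_subset hX.1 hY, mem_union_left _ hX.2.1,
      hunion X hX.1 Y hY hne hX.2.2 hYt⟩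
    have h2 := eq_of_subset_of_card_le subset_union_left h1
    rw [h2]
    exact subset_union_right
  choose! T hTW hvT hTt hTmax using hmax
  have hdisj : ∀ X ∈ W.image T, ∀ Y ∈ W.image T, (X ∩ Y).Nonempty → X = Y := by
    simp only [mem_image]
    rintro _ ⟨v, hv, rfl⟩ _ ⟨w, hw, rfl⟩ hne
    exact (hTmax w hw _ (hTW v hv) (by rwa [inter_comm]) (hTt v hv)).antisymm
      (hTmax v hv _ (hTW w hw) hne (hTt w hw))
  have hcover : (W.image T).biUnion id = W := by
    ext w
    simp only [mem_biUnion, mem_image, id_eq, exists_exists_and_eq_and]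
    exact ⟨fun ⟨v, hv, hw⟩ => hTW v hv hw, fun hw => ⟨w, hw, hvT w hw⟩⟩
  have hne : ∀ X ∈ W.image T, X.Nonempty := by
    simp only [mem_image]
    rintro _ ⟨v, hv, rfl⟩
    exact ⟨v, hvT v hv⟩
  calc ∑ v ∈ W, m v = ∑ X ∈ W.image T, ∑ v ∈ X, m v := by
        conv_lhs => rw [← hcover]
        refine sum_biUnion fun X hX Y hY hXY => ?_
        rw [Function.onFun, disjoint_iff_inter_eq_empty, ← not_nonempty_iff_eq_empty]
        exact fun h => hXY (hdisj X hX Y hY h)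
    _ = ∑ X ∈ W.image T, p X := by
        refine sum_congr rfl fun X hX => ?_
        obtain ⟨v, hv, rfl⟩ := mem_image.1 hX
        exact (hTt v hv).symm
    _ ≤ N := hN _ hne hdisj hcover

/-- A multigraph has an orientation with prescribed in-degrees `m` if every set `X` of vertices
induces at most `∑ v ∈ X, m v` edges, with equality for the whole vertex set. -/
lemma exists_orientation_of_inDegree (W : Finset α) (F : Finset β) (a b : β → α)
    (ha : ∀ e ∈ F, a e ∈ W) (hb : ∀ e ∈ F, b e ∈ W) (m : α → ℕ)
    (hm : ∀ X ⊆ W, #(inducedEdges F a b X) ≤ ∑ v ∈ X, m v) (hF : ∑ v ∈ W, m v ≤ #F) :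
    ∃ tl hd : β → α, (∀ e ∈ F, s(tl e, hd e) = s(a e, b e)) ∧
      ∀ X ⊆ W, ∑ v ∈ X, m v ≤ #(F.filter fun e => hd e ∈ X) := by
  -- Hall's theorem: vertex `v` offers `m v` slots, and each edge picks a slot at one of its ends,
  -- which becomes its head.
  let t : {e // e ∈ F} → Finset (Σ _ : α, ℕ) :=
    fun e => ({a e, b e} : Finset α).sigma fun v => range (m v)
  have hall : ∀ s : Finset {e // e ∈ F}, #s ≤ #(s.biUnion t) := by
    intro s
    let X : Finset α := s.biUnion fun e => {a e, b e}
    have hXW : X ⊆ W := by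
      intro v
      simp only [X, mem_biUnion, mem_insert, mem_singleton]
      rintro ⟨e, -, rfl | rfl⟩
      exacts [ha e e.2, hb e e.2]
    calc #s = #(s.map (Function.Embedding.subtype _)) := (card_map _).symm
      _ ≤ #(inducedEdges F a b X) := by
          refine card_le_card fun e he => ?_
          obtain ⟨e', he', rfl⟩ := mem_map.1 he
          simp only [inducedEdges, mem_filter, X, mem_biUnion, mem_insert, mem_singleton]
          exact ⟨e'.2, ⟨e', he', Or.inl rfl⟩, ⟨e', he', Or.inr rfl⟩⟩
      _ ≤ ∑ v ∈ X, m v := hm X hXW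
      _ = #(X.sigma fun v => range (m v)) := by simp
      _ ≤ #(s.biUnion t) := by
          refine card_le_card fun x => ?_
          simp only [X, t, mem_sigma, mem_biUnion]
          rintro ⟨⟨e, he, hv⟩, hr⟩
          exact ⟨e, he, hv, hr⟩
  obtain ⟨f, hinj, hf⟩ := (all_card_le_biUnion_card_iff_exists_injective t).1 hall
  have hf' : ∀ e : {e // e ∈ F}, (f e).1 = a e ∨ (f e).1 = b e := by
    intro e
    have := (mem_sigma.1 (hf e)).1
    simpa using this
  have hsub : univ.image f ⊆ W.sigma fun v => range (m v) := by
    intro x hx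
    obtain ⟨e, -, rfl⟩ := mem_image.1 hx
    refine mem_sigma.2 ⟨?_, (mem_sigma.1 (hf e)).2⟩
    rcases hf' e with h | h <;> rw [h]
    exacts [ha e e.2, hb e e.2]
  -- There are at most `#F` slots, so the injective matching fills all of them.
  have hsurj : univ.image f = W.sigma fun v => range (m v) := by
    refine eq_of_subset_of_card_le hsub ?_
    rw [card_image_of_injective _ hinj]
    simpa using hF
  refine ⟨fun e => if h : e ∈ F then (if (f ⟨e, h⟩).1 = a e then b e else a e) else a e,
    fun e => if h : e ∈ F then (f ⟨e, h⟩).1 else a e, ?_, ?_⟩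
  · intro e he
    simp only [he, dite_true]
    split_ifs with h
    · rw [h, Sym2.eq_swap]
    · rw [(hf' ⟨e, he⟩).resolve_left h]
  · intro X hX
    calc ∑ v ∈ X, m v = #(X.sigma fun v => range (m v)) := by simp
      _ ≤ #((univ.filter fun e : {e // e ∈ F} => (f e).1 ∈ X).image f) := by
          refine card_le_card fun x hx => ?_
          have hx' := mem_sigma.1 hx
          have : x ∈ univ.image f := by
            rw [hsurj]
            exact mem_sigma.2 ⟨hX hx'.1, hx'.2⟩
          obtain ⟨e, -, rfl⟩ := mem_image.1 this
          exact mem_image.2 ⟨e, by simpa using hx'.1, rfl⟩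
      _ ≤ #((univ.filter fun e : {e // e ∈ F} => (f e).1 ∈ X).map
            (Function.Embedding.subtype _)) := by
          rw [card_map]
          exact card_image_le
      _ ≤ _ := by
          refine card_le_card fun e he => ?_
          obtain ⟨e', he', rfl⟩ := mem_map.1 he
          simp only [mem_filter, mem_univ, true_and] at he'
          simp only [mem_filter, Function.Embedding.subtype_apply, e'.2, dite_true, true_and]
          exact he'

/-- Frank's orientation theorem for intersecting supermodular functions. -/
theorem exists_orientation (W : Finset α) (F : Finset β) (a b : β → α)
    (ha : ∀ e ∈ F, a e ∈ W) (hb : ∀ e ∈ F, b e ∈ W) (h : Finset α → ℕ)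
    (hsup : ∀ X ⊆ W, ∀ Y ⊆ W, (X ∩ Y).Nonempty → h X + h Y ≤ h (X ∪ Y) + h (X ∩ Y))
    (hpart : ∀ P : Finset (Finset α), (∀ X ∈ P, X.Nonempty) →
      (∀ X ∈ P, ∀ Y ∈ P, (X ∩ Y).Nonempty → X = Y) → P.biUnion id = W →
      ∑ X ∈ P, h X ≤ #(F.filter fun e => ∀ X ∈ P, ¬ (a e ∈ X ∧ b e ∈ X))) :
    ∃ tl hd : β → α, (∀ e ∈ F, s(tl e, hd e) = s(a e, b e)) ∧
      ∀ X ⊆ W, X.Nonempty → h X ≤ #(enteringArcs F tl hd X) := by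
  -- Arcs with head in X are either induced by X or enter it, so in-degrees must dominate induced
  -- edges plus demand.
  obtain ⟨m, hm, hmF⟩ := exists_sum_ge_of_supermodular W
    (fun X => #(inducedEdges F a b X) + h X) #F
    (by
      intro X hX Y hY hne
      have h1 := card_inducedEdges_add_le F a b X Y
      have h2 := hsup X hX Y hY hne
      omega)
    (by
      intro P hne hdisj hcover
      have h1 := hpart P hne hdisj hcover
      have h2 : ∑ X ∈ P, #(inducedEdges F a b X) = #(P.biUnion (inducedEdges F a b)) := by
        refine (card_biUnion fun X hX Y hY hXY => ?_).symm
        rw [Function.onFun, Finset.disjoint_left]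
        intro e h1 h2
        simp only [inducedEdges, mem_filter] at h1 h2
        exact hXY (hdisj X hX Y hY ⟨a e, mem_inter.2 ⟨h1.2.1, h2.2.1⟩⟩)
      have h3 : #(P.biUnion (inducedEdges F a b)) +
          #(F.filter fun e => ∀ X ∈ P, ¬ (a e ∈ X ∧ b e ∈ X)) ≤ #F := by
        rw [← card_union_of_disjoint]
        · refine card_le_card fun e => ?_
          simp only [inducedEdges, mem_union, mem_biUnion, mem_filter]
          tauto
        · rw [Finset.disjoint_left]
          intro e
          simp only [inducedEdges, mem_biUnion, mem_filter]
          rintro ⟨X, hX, -, h⟩ ⟨-, h'⟩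
          exact h' X hX h
      rw [sum_add_distrib, h2]
      omega)
  obtain ⟨tl, hd, hlink, hdeg⟩ := exists_orientation_of_inDegree W F a b ha hb m
    (by
      intro X hX
      rcases X.eq_empty_or_nonempty with rfl | hne
      · simp [inducedEdges]
      · exact (Nat.le_add_right _ _).trans (hm X hX hne)) hmF
  refine ⟨tl, hd, hlink, fun X hX hne => ?_⟩
  have h1 := hm X hX hne
  have h2 := hdeg X hX
  have h3 : F.filter (fun e => hd e ∈ X) = inducedEdges F a b X ∪ enteringArcs F tl hd X := by
    ext e
    simp only [inducedEdges, enteringArcs, mem_union, mem_filter]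
    by_cases he : e ∈ F
    · rcases Sym2.eq_iff.1 (hlink e he) with ⟨h, h'⟩ | ⟨h, h'⟩ <;> rw [h, h'] <;> tauto
    · tauto
  have h4 := card_union_le (inducedEdges F a b X) (enteringArcs F tl hd X)
  rw [← h3] at h4
  omega

end Orientation

/-! ### Natural-number rank of a matroid on a finite type -/

section Rank

variable {ι : Type*} (M : Matroid ι)

lemma coe_rank [Finite ι] (X : Set ι) : (rank M X : ℕ∞) = M.eRk X :=
  ENat.natCast_toNat ((M.eRk_le_encard X).trans_lt X.toFinite.encard_lt_top).ne

lemma rank_mono [Finite ι] {X Y : Set ι} (h : X ⊆ Y) : rank M X ≤ rank M Y := by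
  have := M.eRk_mono h
  rwa [← coe_rank, ← coe_rank, Nat.cast_le] at this

lemma rank_inter_add_rank_union_le [Finite ι] (X Y : Set ι) :
    rank M (X ∩ Y) + rank M (X ∪ Y) ≤ rank M X + rank M Y := by
  have := M.eRk_inter_add_eRk_union_le X Y
  simp only [← coe_rank] at this
  exact_mod_cast this

lemma rank_closure (X : Set ι) : rank M (M.closure X) = rank M X := by
  rw [rank, M.eRk_closure_eq, rank]

lemma rank_le_rank_add_ncard_sdiff [Finite ι] (X Y : Set ι) :
    rank M X ≤ rank M Y + (X \ Y).ncard := by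
  have h1 := M.eRk_union_le_eRk_add_encard Y (X \ Y)
  have h2 := M.eRk_mono (show X ⊆ Y ∪ X \ Y from fun x hx => by
    by_cases h : x ∈ Y
    exacts [Or.inl h, Or.inr ⟨hx, h⟩])
  have h3 := h2.trans h1
  rw [← coe_rank, ← coe_rank, ← (X \ Y).toFinite.cast_ncard_eq] at h3
  exact_mod_cast h3

variable {M}

lemma rank_insert_of_notMem_closure [Finite ι] (hM : M.E = Set.univ) {X : Set ι} {i : ι}
    (hi : i ∉ M.closure X) :
    rank M (insert i X) = rank M X + 1 := by
  have := M.eRk_insert_eq_add_one ⟨hM ▸ Set.mem_univ i, hi⟩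
  simp only [← coe_rank] at this
  exact_mod_cast this

lemma spanning_iff_le_rank [Finite ι] (hM : M.E = Set.univ) {k : ℕ} (hk : M.eRank = k)
    {X : Set ι} :
    M.Spanning X ↔ k ≤ rank M X := by
  have : M.RankFinite := by
    rw [← Matroid.eRank_ne_top_iff, hk]
    exact ENat.natCast_ne_top k
  rw [Matroid.spanning_iff_eRk_le', hk, ← coe_rank, Nat.cast_le, hM]
  simp

end Rank

/-! ### Passing matroid elements along arcs -/

section Packing

open Finset
open scoped Classical

variable {α β ι : Type*} [Finite ι] {M : Matroid ι}

/-- Entering arcs are submodular, and so is rank, applied here to the closures of the two label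
sets. Both inequalities sum to at most 2k, while the invariant gives at least 2k on union and
intersection, so nothing is lost: the intersection is tight, and `i`, lying in both closures, cannot
raise its rank. -/
lemma closure_inter_of_tight (hM : M.E = Set.univ) {k : ℕ} {W : Finset α} {F : Finset β}
    {tl hd : β → α} {A : α → Set ι}
    (hA : ∀ X ⊆ W, X.Nonempty → k ≤ #(enteringArcs F tl hd X) + rank M (⋃ v ∈ X, A v))
    {X Y : Finset α} (hX : X ⊆ W) (hY : Y ⊆ W) (hne : (X ∩ Y).Nonempty)
    (hXt : #(enteringArcs F tl hd X) + rank M (⋃ v ∈ X, A v) = k)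
    (hYt : #(enteringArcs F tl hd Y) + rank M (⋃ v ∈ Y, A v) = k)
    {i : ι} (hiX : i ∈ M.closure (⋃ v ∈ X, A v)) (hiY : i ∈ M.closure (⋃ v ∈ Y, A v)) :
    #(enteringArcs F tl hd (X ∩ Y)) + rank M (⋃ v ∈ X ∩ Y, A v) = k ∧
      i ∈ M.closure (⋃ v ∈ X ∩ Y, A v) := by
  have hcl : ∀ S : Set ι, S ⊆ M.closure S := fun S =>
    M.subset_closure S (hM ▸ Set.subset_univ S)
  have h1 := hA _ (inter_subset_left.trans hX) hne
  have h2 := hA _ (union_subset hX hY) (hne.mono (inter_subset_left.trans subset_union_left))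
  have h3 := card_enteringArcs_add_le F tl hd X Y
  have h4 := rank_inter_add_rank_union_le M (M.closure (⋃ v ∈ X, A v)) (M.closure (⋃ v ∈ Y, A v))
  rw [rank_closure, rank_closure] at h4
  have h5 : rank M (⋃ v ∈ X ∪ Y, A v) ≤
      rank M (M.closure (⋃ v ∈ X, A v) ∪ M.closure (⋃ v ∈ Y, A v)) := by
    refine rank_mono M ?_
    rw [Finset.set_biUnion_union]
    exact Set.union_subset_union (hcl _) (hcl _)
  have h6 : rank M (insert i (⋃ v ∈ X ∩ Y, A v)) ≤
      rank M (M.closure (⋃ v ∈ X, A v) ∩ M.closure (⋃ v ∈ Y, A v)) := by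
    refine rank_mono M (Set.insert_subset ⟨hiX, hiY⟩ (Set.subset_inter ?_ ?_)) <;>
    · refine Set.Subset.trans (Set.iUnion₂_subset fun v hv => ?_) (hcl _)
      exact Set.subset_biUnion_of_mem (u := A) (by simp at hv ⊢; tauto)
  have h7 := rank_mono M (Set.subset_insert i (⋃ v ∈ X ∩ Y, A v))
  refine ⟨by omega, ?_⟩
  by_contra h
  have := rank_insert_of_notMem_closure hM h
  omega

/-- As long as some vertex is not spanned, some arc can be used up to pass an element of `M`
from its tail to its head. -/
lemma exists_arc (hM : M.E = Set.univ) {k : ℕ} (hk : M.eRank = k) (W : Finset α) (F : Finset β)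
    (tl hd : β → α) (htl : ∀ e ∈ F, tl e ∈ W) (A : α → Set ι)
    (hA : ∀ X ⊆ W, X.Nonempty → k ≤ #(enteringArcs F tl hd X) + rank M (⋃ v ∈ X, A v))
    (hns : ∃ v ∈ W, ¬ M.Spanning (A v)) :
    ∃ e ∈ F, ∃ i ∈ A (tl e), ∀ X ⊆ W, X.Nonempty →
      k ≤ #(enteringArcs (F.erase e) tl hd X) +
        rank M (⋃ v ∈ X, Function.update A (hd e) (insert i (A (hd e))) v) := by
  have hcl : ∀ S : Set ι, S ⊆ M.closure S := fun S =>
    M.subset_closure S (hM ▸ Set.subset_univ S)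
  have hle : ∀ S : Set ι, rank M S ≤ k := by
    intro S
    have := M.eRk_le_eRank S
    rw [hk, ← coe_rank] at this
    exact_mod_cast this
  obtain ⟨v₀, hv₀, hv₀s⟩ := hns
  -- No arc enters `W`, since all tails lie in it.
  have hW : #(enteringArcs F tl hd W) + rank M (⋃ v ∈ W, A v) = k := by
    have h1 := hA W subset_rfl ⟨v₀, hv₀⟩
    have h2 := hle (⋃ v ∈ W, A v)
    have h3 : enteringArcs F tl hd W = ∅ := by
      refine filter_eq_empty_iff.2 fun e he h => h.2 (htl e he)
    rw [h3, card_empty] at h1 ⊢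
    omega
  -- A smallest tight set with a vertex whose own labels do not span those of the whole set; `W`
  -- with `v₀` is a candidate.
  obtain ⟨X, hX, hXmin⟩ := exists_min_image
    (W.powerset.filter fun X => #(enteringArcs F tl hd X) + rank M (⋃ v ∈ X, A v) = k ∧
      ∃ v ∈ X, ¬ (⋃ v ∈ X, A v) ⊆ M.closure (A v)) card
    ⟨W, by
      simp only [mem_filter, mem_powerset]
      refine ⟨subset_rfl, hW, v₀, hv₀, fun h => hv₀s ?_⟩
      rw [spanning_iff_le_rank hM hk]
      have h1 := rank_mono M h
      rw [rank_closure] at h1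
      have h3 : enteringArcs F tl hd W = ∅ := by
        refine filter_eq_empty_iff.2 fun e he h => h.2 (htl e he)
      rw [h3, card_empty] at hW
      omega⟩
  simp only [mem_filter, mem_powerset] at hX hXmin
  obtain ⟨hXW, hXt, v, hvX, hv⟩ := hX
  let Y := X.filter fun w => A w ⊆ M.closure (A v)
  have hYX : Y ⊆ X := filter_subset _ _
  -- Otherwise every arc entering `Y` enters `X`, while the labels of `Y` have rank strictly below
  -- those of `X`; tightness of `X` would then violate the invariant at `Y`.
  obtain ⟨e, he, heX, heY, heh⟩ : ∃ e ∈ F, tl e ∈ X ∧ tl e ∉ Y ∧ hd e ∈ Y := by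
    by_contra! hcon
    have h1 : enteringArcs F tl hd Y ⊆ enteringArcs F tl hd X := by
      intro e
      simp only [enteringArcs, mem_filter]
      exact fun ⟨he, h1, h2⟩ => ⟨he, hYX h1, fun h => hcon e he h h2 h1⟩
    have h2 := card_le_card h1
    have hvY : v ∈ Y := mem_filter.2 ⟨hvX, hcl _⟩
    have h3 := hA Y (hYX.trans hXW) ⟨v, hvY⟩
    have h4 : rank M (⋃ w ∈ Y, A w) ≤ rank M (A v) := by
      rw [← rank_closure M (A v)]
      exact rank_mono M (Set.iUnion₂_subset fun w hw => (mem_filter.1 hw).2)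
    obtain ⟨j, hj, hjv⟩ := Set.not_subset.1 hv
    have h5 := rank_insert_of_notMem_closure hM hjv
    have h6 : rank M (insert j (A v)) ≤ rank M (⋃ w ∈ X, A w) :=
      rank_mono M (Set.insert_subset hj (Set.subset_biUnion_of_mem (u := A) hvX))
    omega
  have hhX : hd e ∈ X := hYX heh
  obtain ⟨i, hi, hiv⟩ := Set.not_subset.1 fun h => heY (mem_filter.2 ⟨heX, h⟩)
  have hiw : i ∉ M.closure (A (hd e)) := fun h =>
    hiv (M.closure_subset_closure_of_subset_closure (mem_filter.1 heh).2 h)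
  refine ⟨e, he, i, hi, fun Z hZ hZne => ?_⟩
  have hZA := hA Z hZ hZne
  have hmono : rank M (⋃ v ∈ Z, A v) ≤
      rank M (⋃ v ∈ Z, Function.update A (hd e) (insert i (A (hd e))) v) := by
    refine rank_mono M (Set.iUnion₂_mono fun w _ => ?_)
    by_cases hw : w = hd e
    · subst hw
      rw [Function.update_self]
      exact Set.subset_insert _ _
    · rw [Function.update_of_ne hw]
  have hent : enteringArcs (F.erase e) tl hd Z = (enteringArcs F tl hd Z).erase e :=
    filter_erase _ _ _
  by_cases hZe : e ∈ enteringArcs F tl hd Z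
  · have hZe' := (mem_filter.1 hZe).2
    rw [hent, card_erase_of_mem hZe]
    have hpos := card_pos.2 ⟨e, hZe⟩
    -- The invariant at `Z` can fail only if `Z` is tight and already spans `i`. Then `X ∩ Z` is
    -- tight and spans `i`, while `hd e` does not, so it is a candidate; it misses `tl e`, against
    -- minimality of `X`.
    by_contra hcon
    have hins : insert i (⋃ v ∈ Z, A v) ⊆
        ⋃ v ∈ Z, Function.update A (hd e) (insert i (A (hd e))) v := by
      refine Set.insert_subset ?_ (Set.iUnion₂_mono fun w _ => ?_)
      · refine Set.mem_biUnion (show hd e ∈ (Z : Set α) from hZe'.1) ?_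
        rw [Function.update_self]
        exact Set.mem_insert _ _
      · by_cases hw : w = hd e
        · subst hw
          rw [Function.update_self]
          exact Set.subset_insert _ _
        · rw [Function.update_of_ne hw]
    have hins' := rank_mono M hins
    have hiZ : i ∈ M.closure (⋃ v ∈ Z, A v) := by
      by_contra h
      have := rank_insert_of_notMem_closure hM h
      omega
    have hiX : i ∈ M.closure (⋃ v ∈ X, A v) :=
      hcl _ (Set.mem_biUnion (show tl e ∈ (X : Set α) from heX) hi)
    have hmem : hd e ∈ X ∩ Z := mem_inter.2 ⟨hhX, hZe'.1⟩
    obtain ⟨ht, hic⟩ := closure_inter_of_tight hM hA hXW hZ ⟨_, hmem⟩ hXt (by omega) hiX hiZ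
    have hcard := hXmin (X ∩ Z) ⟨inter_subset_left.trans hXW, ht, hd e, hmem, fun h =>
      hiw (M.closure_subset_closure_of_subset_closure h hic)⟩
    have heq := eq_of_subset_of_card_le inter_subset_left hcard
    exact hZe'.2 (mem_inter.1 (heq.symm.subset heX)).2
  · rw [hent, erase_eq_of_notMem hZe]
    omega

end Packing

/-! ### Growing rooted-components by an edge -/

section Components

variable {α β ι : Type*} {G : Graph α β}

lemma edgeVertices_insert {C : Set β} {e : β} {u v : α} (he : G.IsLink e u v) :
    edgeVertices G (insert e C) = edgeVertices G C ∪ {u, v} := by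
  ext x
  constructor
  · rintro ⟨f, rfl | hf, hx⟩
    · exact Or.inr (hx.eq_or_eq_of_isLink he)
    · exact Or.inl ⟨f, hf, hx⟩
  · rintro (⟨f, hf, hx⟩ | rfl | rfl)
    exacts [⟨f, Or.inr hf, hx⟩, ⟨e, Or.inl rfl, he.inc_left⟩, ⟨e, Or.inl rfl, he.inc_right⟩]

lemma IsRootedComponent.reflTransGen {C : Set β} {r x : α} (h : IsRootedComponent G C r)
    (hx : x ∈ spannedVertices G C r) :
    Relation.ReflTransGen (fun u v => ∃ e ∈ C, G.IsLink e u v) r x := by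
  rcases hx with hx | rfl
  · rcases h.empty_or_connected with rfl | ⟨hc, hr⟩
    · obtain ⟨e, he, -⟩ := hx
      exact he.elim
    · exact hc r hr x hx
  · exact .refl

lemma reflTransGen_link_symm {C : Set β} {x y : α}
    (h : Relation.ReflTransGen (fun u v => ∃ e ∈ C, G.IsLink e u v) x y) :
    Relation.ReflTransGen (fun u v => ∃ e ∈ C, G.IsLink e u v) y x := by
  induction h with
  | refl => exact .refl
  | tail _ hbc ih =>
    obtain ⟨e, he, hl⟩ := hbc
    exact .head ⟨e, he, hl.symm⟩ ih

lemma spannedVertices_insert {C : Set β} {r u v : α} {e : β}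
    (he : G.IsLink e u v) (hu : u ∈ spannedVertices G C r) :
    spannedVertices G (insert e C) r = insert v (spannedVertices G C r) := by
  unfold spannedVertices at hu ⊢
  rw [edgeVertices_insert he]
  ext x
  simp only [Set.mem_union, Set.mem_insert_iff, Set.mem_singleton_iff] at hu ⊢
  constructor
  · rintro ((h | rfl | h) | h) <;> tauto
  · tauto

lemma IsRootedComponent.insert {C : Set β} {r u v : α} {e : β} (h : IsRootedComponent G C r)
    (he : G.IsLink e u v) (hu : u ∈ spannedVertices G C r) :
    IsRootedComponent G (insert e C) r := by
  refine ⟨Set.insert_subset he.edge_mem h.subset_edgeSet, h.root_mem, Or.inr ?_⟩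
  have hsub : edgeVertices G (Insert.insert e C) ⊆ Insert.insert v (spannedVertices G C r) := by
    rw [← spannedVertices_insert he hu]
    exact Set.subset_union_left
  have hmono : ∀ {x y}, Relation.ReflTransGen (fun u v => ∃ e ∈ C, G.IsLink e u v) x y →
      Relation.ReflTransGen (fun u v => ∃ f ∈ Insert.insert e C, G.IsLink f u v) x y :=
    fun h => h.lift id fun _ _ ⟨f, hf, hl⟩ => ⟨f, Or.inr hf, hl⟩
  have hreach : ∀ x ∈ Insert.insert v (spannedVertices G C r),
      Relation.ReflTransGen (fun u v => ∃ f ∈ Insert.insert e C, G.IsLink f u v) r x := by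
    rintro x (rfl | hx)
    · exact (hmono (h.reflTransGen hu)).tail ⟨e, Or.inl rfl, he⟩
    · exact hmono (h.reflTransGen hx)
  refine ⟨fun x hx y hy => (reflTransGen_link_symm (hreach x (hsub hx))).trans
    (hreach y (hsub hy)), ?_⟩
  rw [edgeVertices_insert he]
  rcases h.empty_or_connected with rfl | ⟨-, hr⟩
  · rcases hu with ⟨_, h, -⟩ | rfl
    · exact h.elim
    · exact Or.inr (Or.inl rfl)
  · exact Or.inl hr

end Components

/-! ### From the partition inequality to a decomposition -/

section Sufficiency

open Finset
open scoped Classical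

variable {α β ι : Type*} {G : Graph α β} {M : Matroid ι}

/-- Induction on the number of unused arcs `F`: the arc and label from `exists_arc` extend one
component by an edge at a vertex it already spans. With no arcs left, `exists_arc` rules out an
unspanned vertex. -/
lemma exists_packing [Finite ι] (hM : M.E = Set.univ) {k : ℕ} (hk : M.eRank = k) (r : ι → α)
    (W : Finset α) (tl hd : β → α) (F : Finset β) (htl : ∀ e ∈ F, tl e ∈ W)
    (hlink : ∀ e ∈ F, G.IsLink e (tl e) (hd e)) (C : ι → Set β)
    (hC : ∀ i, IsRootedComponent G (C i) (r i)) (hdisj : ∀ i j, i ≠ j → Disjoint (C i) (C j))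
    (hCF : ∀ e ∈ F, ∀ i, e ∉ C i)
    (hA : ∀ X ⊆ W, X.Nonempty → k ≤ #(enteringArcs F tl hd X) +
      rank M (⋃ v ∈ X, {i | v ∈ spannedVertices G (C i) (r i)})) :
    ∃ C' : ι → Set β, (∀ i, IsRootedComponent G (C' i) (r i)) ∧
      (∀ i j, i ≠ j → Disjoint (C' i) (C' j)) ∧
      ∀ v ∈ W, M.Spanning {i | v ∈ spannedVertices G (C' i) (r i)} := by
  induction hn : #F generalizing F C with
  | zero =>
    refine ⟨C, hC, hdisj, ?_⟩
    by_contra! hns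
    obtain ⟨e, he, -⟩ := exists_arc hM hk W F tl hd htl _ hA hns
    rw [card_eq_zero.1 hn] at he
    exact absurd he (notMem_empty e)
  | succ n ih =>
    by_cases hns : ∀ v ∈ W, M.Spanning {i | v ∈ spannedVertices G (C i) (r i)}
    · exact ⟨C, hC, hdisj, hns⟩
    push Not at hns
    obtain ⟨e, he, i, hi, hA'⟩ := exists_arc hM hk W F tl hd htl _ hA hns
    have hnew : ∀ v, {j | v ∈ spannedVertices G
        (Function.update C i (insert e (C i)) j) (r j)} =
        Function.update (fun v => {i | v ∈ spannedVertices G (C i) (r i)}) (hd e)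
          (insert i {i | hd e ∈ spannedVertices G (C i) (r i)}) v := by
      intro v
      ext j
      have h1 : j = i → (v ∈ spannedVertices G (insert e (C i)) (r i) ↔
          v = hd e ∨ v ∈ spannedVertices G (C i) (r i)) := by
        rintro rfl
        rw [spannedVertices_insert (hlink e he) hi, Set.mem_insert_iff]
      by_cases hj : j = i
      · subst hj
        by_cases hv : v = hd e
        · subst hv
          simpa using h1 rfl
        · simpa [hv] using h1 rfl
      · by_cases hv : v = hd e
        · subst hv
          simp [hj]
        · simp [hj, hv]
    refine ih (F.erase e) (fun f hf => htl f (mem_of_mem_erase hf))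
      (fun f hf => hlink f (mem_of_mem_erase hf)) (Function.update C i (insert e (C i)))
      ?_ ?_ ?_ ?_ ?_
    · intro j
      by_cases hj : j = i
      · subst hj
        rw [Function.update_self]
        exact (hC j).insert (hlink e he) hi
      · rw [Function.update_of_ne hj]
        exact hC j
    · intro j l hjl
      by_cases hj : j = i
      · subst hj
        rw [Function.update_self, Function.update_of_ne hjl.symm, Set.disjoint_insert_left]
        exact ⟨hCF e he l, hdisj j l hjl⟩
      · rw [Function.update_of_ne hj]
        by_cases hl : l = i
        · subst hl
          rw [Function.update_self, Set.disjoint_insert_right]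
          exact ⟨hCF e he j, hdisj j l hjl⟩
        · rw [Function.update_of_ne hl]
          exact hdisj j l hjl
    · intro f hf j
      obtain ⟨hfe, hf⟩ := mem_erase.1 hf
      by_cases hj : j = i
      · subst hj
        rw [Function.update_self, Set.mem_insert_iff, not_or]
        exact ⟨hfe, hCF f hf j⟩
      · rw [Function.update_of_ne hj]
        exact hCF f hf j
    · simpa only [hnew] using hA'
    · rw [card_erase_of_mem he, hn, Nat.add_sub_cancel]

/-- Edge-disjoint rooted-components covering all vertices extend to a decomposition of the whole
edge set. -/
lemma exists_decomposition_of_packing [Nonempty α] [Nonempty ι] (hE : E(G).Finite) (r : ι → α)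
    (C : ι → Set β) (hC : ∀ i, IsRootedComponent G (C i) (r i))
    (hdisj : ∀ i j, i ≠ j → Disjoint (C i) (C j))
    (hcov : ∀ v ∈ V(G), ∃ i, v ∈ spannedVertices G (C i) (r i)) :
    ∃ C' : ι → Set β, IsRootedComponentDecomposition G r C' ∧
      ∀ i, spannedVertices G (C i) (r i) ⊆ spannedVertices G (C' i) (r i) := by
  choose! g hg using hcov
  choose! a b hab using fun e (he : e ∈ E(G)) => G.exists_isLink_of_mem_edgeSet he
  let D : Set β := E(G) \ ⋃ i, C i
  have hlink : ∀ e ∈ D, G.IsLink e (a e) (b e) := fun e he => hab e he.1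
  have hDC : ∀ e ∈ D, ∀ i, e ∉ C i := fun e he i h => he.2 (Set.mem_iUnion.2 ⟨i, h⟩)
  -- Each leftover edge goes to a component of the original packing spanning its end `a e`, so the
  -- order of insertion is immaterial.
  have key : ∀ i, ∀ S : Set β, S.Finite → S ⊆ {e ∈ D | g (a e) = i} →
      IsRootedComponent G (C i ∪ S) (r i) ∧
        spannedVertices G (C i) (r i) ⊆ spannedVertices G (C i ∪ S) (r i) := by
    intro i S hS
    induction S, hS using Set.Finite.induction_on with
    | empty => simpa using hC i
    | @insert e S _ _ ih =>
      intro hsub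
      obtain ⟨h1, h2⟩ := ih ((Set.subset_insert _ _).trans hsub)
      obtain ⟨heD, hei⟩ := hsub (Set.mem_insert _ _)
      have ha : a e ∈ spannedVertices G (C i ∪ S) (r i) :=
        h2 (hei ▸ hg _ (hlink e heD).left_mem)
      rw [Set.union_insert]
      refine ⟨h1.insert (hlink e heD) ha, ?_⟩
      rw [spannedVertices_insert (hlink e heD) ha]
      exact h2.trans (Set.subset_insert _ _)
  have key' := fun i => key i {e ∈ D | g (a e) = i} (hE.subset fun e he => he.1.1) subset_rfl
  refine ⟨fun i => C i ∪ {e ∈ D | g (a e) = i}, ⟨fun i => (key' i).1, ?_, ?_⟩,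
    fun i => (key' i).2⟩
  · intro i j hij
    rw [Set.disjoint_left]
    rintro e (h1 | h1) (h2 | h2)
    · exact Set.disjoint_left.1 (hdisj i j hij) h1 h2
    · exact hDC e h2.1 i h1
    · exact hDC e h1.1 j h2
    · exact hij (h1.2.symm.trans h2.2)
  · refine (Set.iUnion_subset fun i => (key' i).1.subset_edgeSet).antisymm fun e he => ?_
    by_cases h : e ∈ ⋃ i, C i
    · obtain ⟨i, hi⟩ := Set.mem_iUnion.1 h
      exact Set.mem_iUnion.2 ⟨i, Or.inl hi⟩
    · exact Set.mem_iUnion.2 ⟨g (a e), Or.inr ⟨⟨he, h⟩, rfl⟩⟩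

/-- A partition of the vertex set into nonempty finite sets, as a `Finpartition`. -/
noncomputable def finpartitionOfFinsets (V : Set α) (P : Finset (Finset α))
    (hne : ∀ X ∈ P, X.Nonempty) (hdisj : ∀ X ∈ P, ∀ Y ∈ P, (X ∩ Y).Nonempty → X = Y)
    (hcover : (P.biUnion id : Finset α) = V) : Finpartition V where
  parts := P.image fun X : Finset α => (X : Set α)
  supIndep := by
    rw [supIndep_iff_pairwiseDisjoint]
    intro X hX Y hY hXY
    obtain ⟨X, hXP, rfl⟩ := mem_image.1 hX
    obtain ⟨Y, hYP, rfl⟩ := mem_image.1 hY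
    refine Set.disjoint_left.2 fun x hx hy => hXY ?_
    rw [hdisj X hXP Y hYP ⟨x, mem_inter.2 ⟨hx, hy⟩⟩]
  sup_parts := by
    rw [← hcover]
    ext x
    simp
  bot_notMem := by
    intro h
    obtain ⟨X, hX, h⟩ := mem_image.1 h
    exact (hne X hX).ne_empty (by simpa using h)

theorem exists_decomposition [Finite ι] (hV : V(G).Finite) (hE : E(G).Finite) (r : ι → α)
    (hr : ∀ i, r i ∈ V(G)) (hM : M.E = Set.univ) {k : ℕ} (hk : M.eRank = k) (hk_pos : 1 ≤ k)
    (hpart : ∀ P : Finpartition V(G), k * #P.parts ≤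
      (crossingEdges G P).ncard + ∑ X ∈ P.parts, rank M (rootsIn r X)) :
    ∃ C : ι → Set β, IsRootedComponentDecomposition G r C ∧
      ∀ v ∈ V(G), M.Spanning {i | v ∈ spannedVertices G (C i) (r i)} := by
  have hle : ∀ S : Set ι, rank M S ≤ k := by
    intro S
    have := M.eRk_le_eRank S
    rw [hk, ← coe_rank] at this
    exact_mod_cast this
  have : Nonempty ι := by
    by_contra hι
    rw [not_nonempty_iff] at hι
    have h0 : (∅ : Set ι) = M.E := Subsingleton.elim _ _
    have h1 := M.eRk_ground
    rw [← h0, Matroid.eRk_empty, hk] at h1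
    have : 0 = k := by exact_mod_cast h1
    omega
  have : Nonempty α := ⟨r (Classical.arbitrary ι)⟩
  choose! a b hab using fun e (he : e ∈ E(G)) => G.exists_isLink_of_mem_edgeSet he
  obtain ⟨tl, hd, hori, hent⟩ := exists_orientation hV.toFinset hE.toFinset a b
    (by simpa using fun e he => (hab e he).left_mem)
    (by simpa using fun e he => (hab e he).right_mem)
    -- Ranks never exceed `k`, so the truncated subtraction is exact.
    (fun X => k - rank M (rootsIn r X))
    (by
      intro X _ Y _ _
      have h1 := rank_inter_add_rank_union_le M (rootsIn r X) (rootsIn r Y)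
      have h2 : rootsIn r ((X ∩ Y : Finset α) : Set α) = rootsIn r X ∩ rootsIn r Y := by
        ext i
        simp [rootsIn]
      have h3 : rootsIn r ((X ∪ Y : Finset α) : Set α) = rootsIn r X ∪ rootsIn r Y := by
        ext i
        simp [rootsIn]
      have h4 := hle (rootsIn r X)
      have h5 := hle (rootsIn r Y)
      rw [h2, h3]
      omega)
    (by
      intro P hne hdisj hcover
      have hcover' : (P.biUnion id : Finset α) = V(G) := by
        rw [hcover, Set.Finite.coe_toFinset]
      let Q := finpartitionOfFinsets V(G) P hne hdisj hcover'
      have hinj : Function.Injective fun X : Finset α => (X : Set α) := coe_injective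
      have h1 := hpart Q
      have h2 : #Q.parts = #P := card_image_of_injective _ hinj
      have h3 : ∑ X ∈ Q.parts, rank M (rootsIn r X) = ∑ X ∈ P, rank M (rootsIn r X) :=
        sum_image fun X _ Y _ h => hinj h
      have h4 : (crossingEdges G Q).ncard ≤
          #(hE.toFinset.filter fun e => ∀ X ∈ P, ¬ (a e ∈ X ∧ b e ∈ X)) := by
        rw [← Set.ncard_coe_finset]
        refine Set.ncard_le_ncard ?_ (finite_toSet _)
        rintro e ⟨X, hX, Y, hY, hXY, x, hx, y, hy, hl⟩
        obtain ⟨X, hXP, rfl⟩ := mem_image.1 hX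
        obtain ⟨Y, hYP, rfl⟩ := mem_image.1 hY
        simp only [coe_filter, Set.Finite.mem_toFinset]
        refine ⟨hl.edge_mem, fun Z hZ hab' => hXY ?_⟩
        have h5 : x ∈ Z ∧ y ∈ Z := by
          rcases hl.eq_and_eq_or_eq_and_eq (hab e hl.edge_mem) with ⟨h, h'⟩ | ⟨h, h'⟩ <;>
            rw [h, h'] <;> tauto
        rw [hdisj X hXP Z hZ ⟨x, mem_inter.2 ⟨hx, h5.1⟩⟩,
          hdisj Y hYP Z hZ ⟨y, mem_inter.2 ⟨hy, h5.2⟩⟩]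
      have h5 : ∑ X ∈ P, (k - rank M (rootsIn r X)) + ∑ X ∈ P, rank M (rootsIn r X) = k * #P := by
        rw [← sum_add_distrib, sum_congr rfl fun X _ => Nat.sub_add_cancel (hle _), sum_const,
          smul_eq_mul, mul_comm]
      rw [h2, h3] at h1
      omega)
  have hlink : ∀ e ∈ hE.toFinset, G.IsLink e (tl e) (hd e) := by
    intro e he
    have h := hab e (by simpa using he)
    rcases Sym2.eq_iff.1 (hori e he) with ⟨h1, h2⟩ | ⟨h1, h2⟩ <;> rw [h1, h2]
    exacts [h, h.symm]
  obtain ⟨C, hC, hCdisj, hCs⟩ := exists_packing hM hk r hV.toFinset tl hd hE.toFinset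
    -- With all components empty, the labels in X are the roots in X, so the orientation property is
    -- the initial invariant.
    (fun e he => by simpa using (hlink e he).left_mem) hlink (fun _ => ∅)
    (fun i => ⟨Set.empty_subset _, hr i, Or.inl rfl⟩) (fun _ _ _ => Set.disjoint_empty _)
    (fun _ _ _ => id)
    (by
      intro X hX hne
      have h1 := hent X hX hne
      have h2 : ⋃ v ∈ X, {i | v ∈ spannedVertices G ∅ (r i)} = rootsIn r (X : Set α) := by
        ext i
        simp [rootsIn, spannedVertices, edgeVertices]
      rw [h2]
      omega)
  obtain ⟨C', hC', hsub⟩ := exists_decomposition_of_packing hE r C hC hCdisj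
    (by
      intro v hv
      have h1 := hCs v (by simpa using hv)
      rw [spanning_iff_le_rank hM hk] at h1
      by_contra! hcon
      have h2 : {i | v ∈ spannedVertices G (C i) (r i)} = ∅ :=
        Set.eq_empty_of_forall_notMem hcon
      rw [h2, rank, Matroid.eRk_empty] at h1
      simp only [ENat.toNat_zero] at h1
      omega)
  exact ⟨C', hC', fun v hv => (hCs v (by simpa using hv)).superset
    (fun i hi => hsub i hi) (hM ▸ Set.subset_univ _)⟩

end Sufficiency

/-! ### Counting crossing edges -/

section Necessity

open Finset
open scoped Classical

variable {α β ι : Type*} {G : Graph α β} {M : Matroid ι}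

lemma exists_mem_parts (P : Finpartition V(G)) {x : α} (hx : x ∈ V(G)) : ∃ X ∈ P.parts, x ∈ X := by
  have h := P.sup_parts
  rw [← h] at hx
  simpa [Finset.mem_sup] using hx

lemma eq_of_mem_parts (P : Finpartition V(G)) {X Y : Set α} (hX : X ∈ P.parts) (hY : Y ∈ P.parts)
    {x : α} (hxX : x ∈ X) (hxY : x ∈ Y) : X = Y := by
  by_contra h
  exact Set.disjoint_left.1 (P.disjoint hX hY h) hxX hxY

/-- A rooted-component has at least as many crossing edges as it meets parts that do not contain
its root. -/
lemma IsRootedComponent.card_parts_le {C : Set β} {r : α} (h : IsRootedComponent G C r)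
    (hE : E(G).Finite) (P : Finpartition V(G)) :
    #(P.parts.filter fun X => r ∉ X ∧ (X ∩ spannedVertices G C r).Nonempty) ≤
      (crossingEdges G P ∩ C).ncard := by
  obtain ⟨R, hR, hrR⟩ := exists_mem_parts P h.root_mem
  have hfin : (crossingEdges G P ∩ C).Finite := hE.subset fun e he => h.subset_edgeSet he.2
  let T : Finset (Set α) → Set β :=
    fun S => {e ∈ crossingEdges G P ∩ C | ∀ x, G.Inc e x → ∃ X ∈ S, x ∈ X}
  have hT : ∀ S, T S ⊆ crossingEdges G P ∩ C := fun S => Set.sep_subset _ _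
  -- With parts contracted, `S` plays the vertex set of a maximal tree grown from the root's part
  -- `R`; the `+ 1` counts `R`.
  obtain ⟨S, hS, hSmax⟩ := exists_max_image
    (P.parts.powerset.filter fun S => R ∈ S ∧ #S ≤ (T S).ncard + 1) card
    ⟨{R}, by simp [hR]⟩
  simp only [mem_filter, mem_powerset] at hS hSmax
  obtain ⟨hSP, hRS, hcard⟩ := hS
  have hreach : ∀ x, Relation.ReflTransGen (fun u v => ∃ e ∈ C, G.IsLink e u v) r x →
      ∃ X ∈ S, x ∈ X := by
    intro x hx
    induction hx with
    | refl => exact ⟨R, hRS, hrR⟩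
    | @tail b c _ hbc ih =>
      obtain ⟨X, hX, hbX⟩ := ih
      obtain ⟨e, he, hl⟩ := hbc
      obtain ⟨Y, hY, hcY⟩ := exists_mem_parts P hl.right_mem
      by_contra hcon
      have hYS : Y ∉ S := fun h => hcon ⟨Y, h, hcY⟩
      have heT : e ∉ T S := fun h => hcon (h.2 c hl.inc_right)
      -- A walk leaving `S` would supply a new part and a new crossing edge, contradicting
      -- maximality.
      have hsub : Insert.insert e (T S) ⊆ T (Insert.insert Y S) := by
        refine Set.insert_subset ⟨⟨⟨X, hSP hX, Y, hY, ?_, b, hbX, c, hcY, hl⟩, he⟩, ?_⟩ ?_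
        · rintro rfl
          exact hYS hX
        · intro x hx
          rcases hx.eq_or_eq_of_isLink hl with rfl | rfl
          exacts [⟨X, mem_insert_of_mem hX, hbX⟩, ⟨Y, mem_insert_self _ _, hcY⟩]
        · rintro f ⟨hf, hf'⟩
          refine ⟨hf, fun x hx => ?_⟩
          obtain ⟨Z, hZ, hxZ⟩ := hf' x hx
          exact ⟨Z, mem_insert_of_mem hZ, hxZ⟩
      have h1 := Set.ncard_le_ncard hsub (hfin.subset (hT _))
      rw [Set.ncard_insert_of_notMem heT (hfin.subset (hT _))] at h1
      have h2 := hSmax (Insert.insert Y S) ⟨insert_subset hY hSP, mem_insert_of_mem hRS, by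
        rw [card_insert_of_notMem hYS]
        omega⟩
      rw [card_insert_of_notMem hYS] at h2
      omega
  have hsub : (P.parts.filter fun X => r ∉ X ∧ (X ∩ spannedVertices G C r).Nonempty) ⊆
      S.erase R := by
    intro X hX
    obtain ⟨hXP, hrX, x, hxX, hx⟩ := mem_filter.1 hX
    obtain ⟨Y, hY, hxY⟩ := hreach x (h.reflTransGen hx)
    obtain rfl := eq_of_mem_parts P hXP (hSP hY) hxX hxY
    exact mem_erase.2 ⟨fun h => hrX (h ▸ hrR), hY⟩
  have h1 := card_le_card hsub
  have h2 := Set.ncard_le_ncard (hT S) hfin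
  rw [card_erase_of_mem hRS] at h1
  omega

theorem IsRootedComponentDecomposition.le_ncard_crossingEdges [Finite ι] {r : ι → α}
    {C : ι → Set β} (hC : IsRootedComponentDecomposition G r C) (hE : E(G).Finite)
    (hM : M.E = Set.univ) {k : ℕ} (hk : M.eRank = k)
    (hs : ∀ v ∈ V(G), M.Spanning {i | v ∈ spannedVertices G (C i) (r i)})
    (P : Finpartition V(G)) :
    k * #P.parts ≤ (crossingEdges G P).ncard + ∑ X ∈ P.parts, rank M (rootsIn r X) := by
  have := Fintype.ofFinite ι
  have hfin : (crossingEdges G P).Finite := by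
    refine hE.subset ?_
    rintro e ⟨X, -, Y, -, -, x, -, y, -, hl⟩
    exact hl.edge_mem
  have h1 : ∀ X ∈ P.parts, k ≤ #(univ.filter fun i =>
      r i ∉ X ∧ (X ∩ spannedVertices G (C i) (r i)).Nonempty) + rank M (rootsIn r X) := by
    intro X hX
    obtain ⟨v, hv⟩ := Set.nonempty_iff_ne_empty.2 (P.ne_bot hX)
    have h2 := (spanning_iff_le_rank hM hk).1 (hs v (P.le hX hv))
    have h3 : rank M {i | v ∈ spannedVertices G (C i) (r i)} ≤
        rank M {i | (X ∩ spannedVertices G (C i) (r i)).Nonempty} :=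
      rank_mono M fun i hi => ⟨v, hv, hi⟩
    have h4 := rank_le_rank_add_ncard_sdiff M
      {i | (X ∩ spannedVertices G (C i) (r i)).Nonempty} (rootsIn r X)
    have h5 : {i | (X ∩ spannedVertices G (C i) (r i)).Nonempty} \ rootsIn r X =
        ((univ.filter fun i =>
          r i ∉ X ∧ (X ∩ spannedVertices G (C i) (r i)).Nonempty : Finset ι) : Set ι) := by
      ext i
      simp [rootsIn, and_comm]
    rw [h5, Set.ncard_coe_finset] at h4
    omega
  -- Double counting of pairs (part, component entering it from a root outside), then disjointness
  -- of the components.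
  have h2 : ∑ X ∈ P.parts, #(univ.filter fun i =>
      r i ∉ X ∧ (X ∩ spannedVertices G (C i) (r i)).Nonempty) ≤ (crossingEdges G P).ncard := by
    calc _ = ∑ i : ι, #(P.parts.filter fun X =>
          r i ∉ X ∧ (X ∩ spannedVertices G (C i) (r i)).Nonempty) :=
          sum_card_bipartiteAbove_eq_sum_card_bipartiteBelow _
      _ ≤ ∑ i : ι, (crossingEdges G P ∩ C i).ncard :=
          sum_le_sum fun i _ => (hC.isRootedComponent i).card_parts_le hE P
      _ = ∑ i : ι, #(hfin.toFinset.filter (· ∈ C i)) := by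
          refine sum_congr rfl fun i _ => ?_
          rw [← Set.ncard_coe_finset]
          congr 1
          ext e
          simp
      _ = #(univ.biUnion fun i => hfin.toFinset.filter (· ∈ C i)) := by
          refine (card_biUnion fun i _ j _ hij => ?_).symm
          rw [Function.onFun, Finset.disjoint_left]
          intro e h1 h2
          exact Set.disjoint_left.1 (hC.disjoint i j hij) (mem_filter.1 h1).2 (mem_filter.1 h2).2
      _ ≤ #hfin.toFinset :=
          card_le_card (biUnion_subset.2 fun i _ => filter_subset _ _)
      _ = (crossingEdges G P).ncard := (Set.ncard_eq_toFinset_card _ hfin).symm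
  calc k * #P.parts = ∑ X ∈ P.parts, k := by rw [sum_const, smul_eq_mul, mul_comm]
    _ ≤ ∑ X ∈ P.parts, (#(univ.filter fun i =>
          r i ∉ X ∧ (X ∩ spannedVertices G (C i) (r i)).Nonempty) + rank M (rootsIn r X)) :=
        sum_le_sum h1
    _ ≤ _ := by
        rw [sum_add_distrib]
        omega

end Necessity

end RootedDecomposition

/-- `G` is a finite multigraph (parallel edges and loops allowed), the multiset of roots is the
finite family `r`, and `M` is a matroid of rank `k` on (the index set of) this family. -/
theorem mainTheorem2 {α β ι : Type*} [Finite ι]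
    (G : Graph α β) (hV : V(G).Finite) (hE : E(G).Finite)
    (r : ι → α) (hr : ∀ i, r i ∈ V(G))
    (M : Matroid ι) (hM : M.E = Set.univ)
    (k : ℕ) (hk : M.eRank = k) (hk_pos : 1 ≤ k) :
    (∃ C : ι → Set β,
        RootedDecomposition.IsRootedComponentDecomposition G r C ∧
        ∀ v ∈ V(G), M.Spanning {i | v ∈ RootedDecomposition.spannedVertices G (C i) (r i)}) ↔
      ∀ P : Finpartition V(G),
        ((RootedDecomposition.crossingEdges G P).ncard : ℤ) ≥
          (k : ℤ) * (P.parts.card : ℤ) -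
            ∑ X ∈ P.parts,
              (RootedDecomposition.rank M (RootedDecomposition.rootsIn r X) : ℤ) := by
  constructor
  · rintro ⟨C, hC, hs⟩ P
    have := hC.le_ncard_crossingEdges hE hM hk hs P
    zify at this
    linarith
  · intro h
    refine RootedDecomposition.exists_decomposition hV hE r hr hM hk hk_pos fun P => ?_
    have := h P
    zify
    linarith
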